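/- Call a subset of a finite-dimensional real vector space $V$ \emph{semidefinite-representable} if it is the projection to $V$ of a set $\{(x,y)\in V\times\mathbb{R}^k : A_0+A(x,y)\succeq 0\}$, where $k \ge 0$, $A_0$ is a real symmetric matrix and $A$ is a linear map into the real symmetric matrices of the same size. For $q\ge 0$ let $\Delta_+^q=\{x\in\mathbb{R}^q : x_1\ge\dots\ge x_q\ge 0\}$. Say that $f:\Delta_+^q\to\mathbb{R}$ has semidefinite-representable lower-level sets if $\{u\in\Delta_+^q : f(u)\le\alpha\}\subseteq\mathbb{R}^q$ is semidefinite-representable for every $\alpha\in\mathbb{R}$. For a real $m\times n$ matrix $M$ let $\sigma(M)\in\Delta_+^{\min\{m,n\}}$ be the vector of its singular values in nonincreasing order, and for a real symmetric $q\times q$ matrix $M$ let $\lambda(M)\in\mathbb{R}^q$ be the vector of its eigenvalues in nonincreasing order, both with multiplicities. Let $K\ge 0$ be an integer and $r\in\mathbb{R}$. (1) Let $q=\min\{m,n\}$, let $f:\Delta_+^q\to\mathbb{R}$ have semidefinite-representable lower-level sets, and let $\bar S=\{M\in\mathbb{R}^{m\times n} : \operatorname{rank}(M)\le K,\ f(\sigma(M))\le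 r\}$. Then $\operatorname{conv}(\bar S)$ is semidefinite-representable, and it is the set of all $M\in\mathbb{R}^{m\times n}$ for which there is $u\in\Delta_+^q$ with $f(u)\le r$, $u_i=0$ for all $i>K$, and $\sum_{i=1}^j u_i\ge\sum_{i=1}^j\sigma_i(M)$ for $j=1,\dots,q$. (2) Let $f:\Delta_+^q\to\mathbb{R}$ have semidefinite-representable lower-level sets, and let $\bar S$ be the set of real symmetric positive semidefinite $q\times q$ matrices $M$ with $\operatorname{rank}(M)\le K$ and $f(\lambda(M))\le r$. Then $\operatorname{conv}(\bar S)$ is semidefinite-representable. It is the set of all real symmetric $q\times q$ matrices $M$ for which there is $u\in\Delta_+^q$ with $f(u)\le r$, $u_i=0$ for all $i>K$, $\sum_{i=1}^j u_i\ge\sum_{i=1}^j\lambda_i(M)$ for $j=1,\dots,q-1$, and $\sum_{i=1}^q u_i=\sum_{i=1}^q\lambda_i(M)$. It is also the set of all positive semidefinite $M$ for which there is $u\in\Delta_+^q$ with $f(u)\le r$, $u_i=0$ for all $i>K$, $\sum_{i=1}^j u_i\ge\sum_{i=1}^j\lambda_i(M)$ for $j=1,\dots,K-1$, and $\sum_{i=1}^{\min\{K,q\}}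 u_i=\sum_{i=1}^q\lambda_i(M)$. -/

import Mathlib

/-- The cone `Δ₊` of vectors `x ∈ ℝ^q` with `x₁ ≥ ⋯ ≥ x_q ≥ 0`. -/
def DeltaPlus (q : ℕ) : Set (Fin q → ℝ) := {x | Antitone x ∧ ∀ i, 0 ≤ x i}

/-- A subset of a real vector space is semidefinite-representable if it is the projection (along
finitely many auxiliary real variables) of the solution set of a linear matrix inequality
`A₀ + A (x, y) ⪰ 0`, where `A₀` is a real symmetric matrix and `A` is a linear map with values in
real symmetric matrices. -/
def SemidefRepresentable {V : Type*} [AddCommGroup V] [Module ℝ V] (S : Set V) : Prop :=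
  ∃ (k d : ℕ) (A₀ : Matrix (Fin d) (Fin d) ℝ)
    (A : V × (Fin k → ℝ) →ₗ[ℝ] Matrix (Fin d) (Fin d) ℝ),
    A₀.IsSymm ∧ (∀ z, (A z).IsSymm) ∧
      S = Prod.fst '' {z : V × (Fin k → ℝ) | (A₀ + A z).PosSemidef}

/-- The lower level set `{u ∈ Δ₊ | f u ≤ α}`, as a subset of `ℝ^q`. -/
def lowerLevelSet {q : ℕ} (f : DeltaPlus q → ℝ) (α : ℝ) : Set (Fin q → ℝ) :=
  Subtype.val '' {u : DeltaPlus q | f u ≤ α}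

/-- `x₁ + ⋯ + x_j` (all of `x` is summed if `j` is at least the dimension). -/
def partialSum {q : ℕ} (x : Fin q → ℝ) (j : ℕ) : ℝ := ∑ i with i.val < j, x i

/-- The vector `σ(M) ∈ Δ₊` of the `min m n` singular values of a real `m × n` matrix, with
multiplicities, in nonincreasing order. -/
noncomputable def singularVec {m n : ℕ} (M : Matrix (Fin m) (Fin n) ℝ) : DeltaPlus (min m n) :=
  ⟨fun i => (Matrix.toEuclideanLin M).singularValues i.val,
    fun _ _ h => (Matrix.toEuclideanLin M).singularValues_antitone h,
    fun i => (Matrix.toEuclideanLin M).singularValues_nonneg i.val⟩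

/-- The vector `λ(M)` of the `q` eigenvalues of a real symmetric matrix, with multiplicities, in
nonincreasing order. -/
noncomputable def eigenVec {q : ℕ} {M : Matrix (Fin q) (Fin q) ℝ} (hM : M.IsHermitian) :
    Fin q → ℝ :=
  fun i => hM.eigenvalues₀ (Fin.cast (Fintype.card_fin q).symm i)

theorem eigenVec_mem_deltaPlus {q : ℕ} {M : Matrix (Fin q) (Fin q) ℝ} (hM : M.PosSemidef) :
    eigenVec hM.isHermitian ∈ DeltaPlus q := by
  refine ⟨fun i j h => hM.isHermitian.eigenvalues₀_antitone (by simpa using h), fun i => ?_⟩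
  have h := hM.eigenvalues_nonneg ((Fintype.equivOfCardEq (Fintype.card_fin _))
    (Fin.cast (Fintype.card_fin q).symm i))
  simpa [Matrix.IsHermitian.eigenvalues, eigenVec] using h

/-- The set of real `m × n` matrices with `rank M ≤ K` and `f (σ(M)) ≤ r`. -/
def rankSingularSet {m n : ℕ} (K : ℕ) (r : ℝ) (f : DeltaPlus (min m n) → ℝ) :
    Set (Matrix (Fin m) (Fin n) ℝ) :=
  {M | M.rank ≤ K ∧ f (singularVec M) ≤ r}

/-- The set of real symmetric positive semidefinite `q × q` matrices with `rank M ≤ K` and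
`f (λ(M)) ≤ r`. -/
def rankEigenSet {q : ℕ} (K : ℕ) (r : ℝ) (f : DeltaPlus q → ℝ) :
    Set (Matrix (Fin q) (Fin q) ℝ) :=
  {M | ∃ hM : M.PosSemidef, M.rank ≤ K ∧ f ⟨eigenVec hM.isHermitian, eigenVec_mem_deltaPlus hM⟩ ≤ r}

/-! Both parts compare the hull with a majorization set. That set contains the generators, with `u`
the vector of singular values or eigenvalues itself. It is semidefinite-representable, hence convex,
so it contains the hull.

Conversely, write `M = Aᵀ diag(σ) B` with orthonormal rows in `A` and `B`. If `σ` is weakly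
majorized by `u`, then it is a convex combination of signed permutations of `u`
(`mem_convexHull_signed_perm`). The linear map `x ↦ Aᵀ diag(x) B` carries this to `M`, and signs and
permutations are absorbed into the frames, so each term has singular values `u` and lies in the
generating set. In the symmetric case plain permutations suffice (`mem_convexHull_perm`), because
the total sums agree.

Representability rests on Ky Fan's semidefinite programs for the sum of the `j` largest eigenvalues
or singular values (`partialSum_le_iff_of_spectral`, `partialSum_le_iff_of_svd`). Their constraints
are linear in the matrix and the bound, so `u` and the dual variables can be projected out. They are
stated for arbitrary decompositions, and therefore also show that the eigenvalues and singular
values do not depend on the decomposition. -/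

open Matrix

/-! ### Calculus of semidefinite-representable sets. -/

namespace SemidefRepresentable

variable {V W Y : Type*} [AddCommGroup V] [Module ℝ V] [AddCommGroup W] [Module ℝ W]
  [AddCommGroup Y] [Module ℝ Y]

/-- The auxiliary variables may live in any finite-dimensional space, and the matrices may be
indexed by any finite type. -/
theorem of_lmi [Module.Finite ℝ Y] {ι : Type*} [Fintype ι] (A₀ : Matrix ι ι ℝ)
    (A : V × Y →ₗ[ℝ] Matrix ι ι ℝ) (h₀ : A₀.IsSymm) (h : ∀ z, (A z).IsSymm) :
    SemidefRepresentable (Prod.fst '' {z : V × Y | (A₀ + A z).PosSemidef}) := by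
  classical
  let e : (Fin (Module.finrank ℝ Y) → ℝ) ≃ₗ[ℝ] Y := (Module.finBasis ℝ Y).equivFun.symm
  let g : Fin (Fintype.card ι) ≃ ι := (Fintype.equivFin ι).symm
  refine ⟨_, _, A₀.submatrix g g,
    (Matrix.reindexLinearEquiv ℝ ℝ g.symm g.symm).toLinearMap ∘ₗ A ∘ₗ
      (LinearMap.id.prodMap e.toLinearMap), h₀.submatrix g, fun z => (h _).submatrix g, ?_⟩
  have key : ∀ z : V × (Fin (Module.finrank ℝ Y) → ℝ),
      (A₀.submatrix g g + ((Matrix.reindexLinearEquiv ℝ ℝ g.symm g.symm).toLinearMap ∘ₗ A ∘ₗ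
      (LinearMap.id.prodMap e.toLinearMap)) z).PosSemidef ↔
      (A₀ + A (z.1, e z.2)).PosSemidef := fun z => by
    rw [← Matrix.posSemidef_submatrix_equiv g]
    rfl
  ext v
  simp only [Set.mem_image, Set.mem_ofPred_eq, key]
  constructor
  · rintro ⟨z, hz, rfl⟩
    exact ⟨(z.1, e.symm z.2), by simpa using hz, rfl⟩
  · rintro ⟨z, hz, rfl⟩
    exact ⟨(z.1, e z.2), hz, rfl⟩

theorem preimage {S : Set W} (hS : SemidefRepresentable S) (L : V →ₗ[ℝ] W) :
    SemidefRepresentable {v | L v ∈ S} := by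
  obtain ⟨k, d, A₀, A, h₀, h, rfl⟩ := hS
  refine ⟨k, d, A₀, A ∘ₗ L.prodMap LinearMap.id, h₀, fun z => h _, ?_⟩
  ext v
  simp

theorem proj [Module.Finite ℝ Y] {S : Set (V × Y)} (hS : SemidefRepresentable S) :
    SemidefRepresentable {v | ∃ y, (v, y) ∈ S} := by
  obtain ⟨k, d, A₀, A, h₀, h, rfl⟩ := hS
  convert of_lmi (Y := Y × (Fin k → ℝ)) A₀
    (A ∘ₗ (LinearEquiv.prodAssoc ℝ V Y (Fin k → ℝ)).symm.toLinearMap) h₀ (fun z => h _) using 1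
  ext v
  simp
  rfl

theorem _root_.Matrix.posSemidef_fromBlocks_zero_iff {ι κ : Type*} [Fintype ι] [Fintype κ]
    {A : Matrix ι ι ℝ} {B : Matrix κ κ ℝ} :
    (fromBlocks A 0 0 B).PosSemidef ↔ A.PosSemidef ∧ B.PosSemidef := by
  refine ⟨fun h => ⟨h.submatrix Sum.inl, h.submatrix Sum.inr⟩, fun ⟨hA, hB⟩ => ?_⟩
  refine .of_dotProduct_mulVec_nonneg ?_ fun x => ?_
  · rw [Matrix.IsHermitian, fromBlocks_conjTranspose, hA.1.eq, hB.1.eq]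
    simp
  · have h1 := hA.dotProduct_mulVec_nonneg (x ∘ Sum.inl)
    have h2 := hB.dotProduct_mulVec_nonneg (x ∘ Sum.inr)
    rw [fromBlocks_mulVec]
    simp only [dotProduct, Fintype.sum_sum_type] at *
    simpa using add_nonneg h1 h2

/-- The two pencils are stacked block-diagonally; each keeps its own auxiliary variables. -/
theorem inter {S T : Set V} (hS : SemidefRepresentable S) (hT : SemidefRepresentable T) :
    SemidefRepresentable (S ∩ T) := by
  obtain ⟨k, d, A₀, A, h₀, h, rfl⟩ := hS
  obtain ⟨k', d', B₀, B, h₀', h', rfl⟩ := hT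
  let C : V × ((Fin k → ℝ) × (Fin k' → ℝ)) →ₗ[ℝ] Matrix (Fin d ⊕ Fin d') (Fin d ⊕ Fin d') ℝ :=
    { toFun := fun z => fromBlocks (A (z.1, z.2.1)) 0 0 (B (z.1, z.2.2))
      map_add' := fun z w => by
        have h1 := A.map_add (z.1, z.2.1) (w.1, w.2.1)
        have h2 := B.map_add (z.1, z.2.2) (w.1, w.2.2)
        simp only [Prod.mk_add_mk] at h1 h2
        simp [fromBlocks_add, h1, h2]
      map_smul' := fun c z => by
        have h1 := A.map_smul c (z.1, z.2.1)
        have h2 := B.map_smul c (z.1, z.2.2)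
        simp only [Prod.smul_mk] at h1 h2
        simp [fromBlocks_smul, h1, h2] }
  convert of_lmi (fromBlocks A₀ 0 0 B₀) C
    (by simp [Matrix.IsSymm, fromBlocks_transpose, h₀.eq, h₀'.eq])
    (fun z => by
      simp [C, Matrix.IsSymm, fromBlocks_transpose, (h (z.1, z.2.1)).eq, (h' (z.1, z.2.2)).eq])
    using 1
  ext v
  simp only [C, LinearMap.coe_mk, AddHom.coe_mk, fromBlocks_add, add_zero,
    posSemidef_fromBlocks_zero_iff, Set.mem_inter_iff, Set.mem_image, Set.mem_ofPred_eq,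
    Prod.exists, exists_and_right, exists_eq_right]
  constructor
  · rintro ⟨⟨x, hx⟩, ⟨y, hy⟩⟩
    exact ⟨x, y, hx, hy⟩
  · rintro ⟨x, y, hx, hy⟩
    exact ⟨⟨x, hx⟩, ⟨y, hy⟩⟩

theorem setOf_posSemidef_of_isSymm {ι : Type*} [Fintype ι] (A : V →ₗ[ℝ] Matrix ι ι ℝ)
    (h : ∀ v, (A v).IsSymm) : SemidefRepresentable {v | (A v).PosSemidef} := by
  convert of_lmi (Y := Fin 0 → ℝ) (0 : Matrix ι ι ℝ) (A ∘ₗ LinearMap.fst ℝ V (Fin 0 → ℝ))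
    (by simp [Matrix.IsSymm]) (fun z => h _) using 1
  ext v
  simp

theorem setOf_nonneg {ι : Type*} [Fintype ι] (L : V →ₗ[ℝ] (ι → ℝ)) :
    SemidefRepresentable {v | 0 ≤ L v} := by
  classical
  convert setOf_posSemidef_of_isSymm (Matrix.diagonalLinearMap ι ℝ ℝ ∘ₗ L)
    (fun v => by simp [Matrix.IsSymm]) using 1
  ext v
  simp [Pi.le_def]

theorem setOf_nonneg_real (L : V →ₗ[ℝ] ℝ) : SemidefRepresentable {v | 0 ≤ L v} := by
  convert setOf_nonneg (LinearMap.pi fun _ : Unit => L) using 1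
  ext v
  simp [Pi.le_def]

theorem setOf_eq_zero {ι : Type*} [Fintype ι] (L : V →ₗ[ℝ] (ι → ℝ)) :
    SemidefRepresentable {v | L v = 0} := by
  convert (setOf_nonneg L).inter (setOf_nonneg (-L)) using 1
  ext v
  simp [le_antisymm_iff, and_comm]

theorem setOf_eq_zero_real (L : V →ₗ[ℝ] ℝ) : SemidefRepresentable {v | L v = 0} := by
  convert setOf_eq_zero (LinearMap.pi fun _ : Unit => L) using 1
  ext v
  simp [funext_iff]

/-- Pencils must take symmetric values, while `A` need not. Symmetry of `A v` is imposed by linear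
equations, and on their solutions `A + Aᵀ` equals `2A`. -/
theorem setOf_posSemidef {ι : Type*} [Fintype ι] (A : V →ₗ[ℝ] Matrix ι ι ℝ) :
    SemidefRepresentable {v | (A v).PosSemidef} := by
  let t : Matrix ι ι ℝ →ₗ[ℝ] Matrix ι ι ℝ := (Matrix.transposeLinearEquiv ι ι ℝ ℝ).toLinearMap
  let skew : V →ₗ[ℝ] (ι × ι → ℝ) :=
    LinearMap.pi fun p => Matrix.entryLinearMap ℝ ℝ p.1 p.2 ∘ₗ (A - t ∘ₗ A)
  convert (setOf_eq_zero skew).inter (setOf_posSemidef_of_isSymm (A + t ∘ₗ A)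
    (fun v => by simp [t, Matrix.IsSymm, add_comm])) using 1
  ext v
  have hskew : skew v = 0 ↔ (A v)ᵀ = A v := by
    simp only [skew, t, funext_iff, ← Matrix.ext_iff, Prod.forall]
    exact forall₂_congr fun i j => sub_eq_zero.trans eq_comm
  simp only [Set.mem_ofPred_eq, Set.mem_inter_iff, hskew]
  constructor
  · intro h
    have hs : (A v)ᵀ = A v := by simpa [Matrix.IsHermitian] using h.1
    exact ⟨hs, by simpa [t, hs] using h.add h⟩
  · rintro ⟨hs, h⟩
    have : (1 / 2 : ℝ) • (A v + A v) = A v := by rw [← two_smul ℝ, smul_smul]; norm_num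
    replace h : (A v + (A v)ᵀ).PosSemidef := h
    rw [hs] at h
    rw [← this]
    exact h.smul (α := ℝ) (by norm_num)

theorem univ : SemidefRepresentable (Set.univ : Set V) := by
  convert setOf_nonneg_real (0 : V →ₗ[ℝ] ℝ) using 1
  simp

theorem forall_mem {α : Type*} (s : Finset α) {S : α → Set V}
    (hS : ∀ i ∈ s, SemidefRepresentable (S i)) :
    SemidefRepresentable {v | ∀ i ∈ s, v ∈ S i} := by
  classical
  induction s using Finset.induction_on with
  | empty => simpa using univ
  | insert a s _ ih =>
    convert (hS a (by simp)).inter (ih fun i hi => hS i (by simp [hi])) using 1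
    ext v
    simp

theorem convex {S : Set V} (hS : SemidefRepresentable S) : Convex ℝ S := by
  obtain ⟨k, d, A₀, A, -, -, rfl⟩ := hS
  refine Convex.is_linear_image (f := Prod.fst) ?_ (LinearMap.fst ℝ V (Fin k → ℝ)).isLinear
  intro x hx y hy a b ha hb hab
  have : A₀ + A (a • x + b • y) = a • (A₀ + A x) + b • (A₀ + A y) := by
    rw [map_add, map_smul, map_smul, smul_add, smul_add]
    nth_rewrite 1 [← one_smul ℝ A₀]
    rw [← hab, add_smul]
    abel
  simp only [Set.mem_ofPred_eq] at hx hy ⊢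
  rw [this]
  exact (hx.smul ha).add (hy.smul hb)

end SemidefRepresentable

/-! ### Partial sums and majorization. -/

theorem partialSum_eq_sum {q : ℕ} (x : Fin q → ℝ) {j : ℕ} (hj : q ≤ j) :
    partialSum x j = ∑ i, x i := by
  rw [partialSum, Finset.filter_true_of_mem fun i _ => i.isLt.trans_le hj]

theorem partialSum_add_eq {q : ℕ} (x : Fin q → ℝ) (i : Fin q) :
    partialSum x (i + 1) = partialSum x i + x i := by
  have : (Finset.univ.filter fun l : Fin q => l.val < i + 1) =
      insert i (Finset.univ.filter fun l : Fin q => l.val < i) := by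
    ext l
    simp [Fin.ext_iff]
    omega
  rw [partialSum, this, Finset.sum_insert (by simp), partialSum, add_comm]

theorem eq_of_partialSum_eq {q : ℕ} {x y : Fin q → ℝ}
    (h : ∀ j ≤ q, partialSum x j = partialSum y j) : x = y := by
  ext i
  have h1 := h (i + 1) i.isLt
  rw [partialSum_add_eq, partialSum_add_eq, h i i.isLt.le] at h1
  exact add_left_cancel h1

theorem partialSum_mono {q : ℕ} {x : Fin q → ℝ} (hx : ∀ i, 0 ≤ x i) : Monotone (partialSum x) :=
  fun _ _ hij => Finset.sum_le_sum_of_subset_of_nonneg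
    (fun l hl => by simp only [Finset.mem_filter] at *; exact ⟨hl.1, hl.2.trans_le hij⟩)
    fun i _ _ => hx i

theorem partialSum_eq_of_eq_zero {q : ℕ} {x : Fin q → ℝ} {k : ℕ}
    (hx : ∀ i, k ≤ i.val → x i = 0) {j : ℕ} (hj : k ≤ j) : partialSum x j = partialSum x k := by
  symm
  refine Finset.sum_subset
    (fun l hl => by simp only [Finset.mem_filter] at *; exact ⟨hl.1, hl.2.trans_le hj⟩) ?_
  intro i _ hi
  exact hx i (by simpa using hi)

/-- The sum of the `j` first coordinates, as a linear form. -/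
def partialSumLinear (q j : ℕ) : (Fin q → ℝ) →ₗ[ℝ] ℝ :=
  ∑ i : Fin q with i.val < j, LinearMap.proj i

@[simp]
theorem partialSumLinear_apply {q j : ℕ} (x : Fin q → ℝ) :
    partialSumLinear q j x = partialSum x j := by
  simp [partialSumLinear, partialSum]

/-- Abel summation, by peeling off the last index. The constant `c` stays free so that the induction
hypothesis can be used with the last, smallest coefficient. Weak majorization takes `c = 0`;
majorization takes `c` to be the last coefficient, where the total vanishes. -/
theorem mul_sum_le_sum_mul_of_partialSum_nonneg {q : ℕ} {d w : Fin q → ℝ} (hd : Antitone d)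
    (hw : ∀ j ≤ q, 0 ≤ partialSum w j) {c : ℝ} (hc : ∀ i, c ≤ d i) :
    c * ∑ i, w i ≤ ∑ i, d i * w i := by
  induction q generalizing c with
  | zero => simp
  | succ q ih =>
    have hw' : ∀ j ≤ q, partialSum (fun i : Fin q => w i.castSucc) j = partialSum w j := by
      intro j hj
      simp only [partialSum, Finset.sum_filter]
      rw [Fin.sum_univ_castSucc]
      simp [hj]
    have h1 := ih (d := fun i => d i.castSucc) (w := fun i => w i.castSucc)
      (fun i j hij => hd (by simpa using hij)) (fun j hj => by
        rw [hw' j hj]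
        exact hw j (by omega)) (c := d (Fin.last q)) (fun i => hd (Fin.le_last _))
    have h2 : 0 ≤ ∑ i, w i := by
      have := hw (q + 1) le_rfl
      rwa [partialSum_eq_sum _ le_rfl] at this
    calc c * ∑ i, w i ≤ d (Fin.last q) * ∑ i, w i := by gcongr; exact hc _
      _ ≤ ∑ i, d i * w i := by
        rw [Fin.sum_univ_castSucc, Fin.sum_univ_castSucc, mul_add]
        gcongr

theorem sum_mul_le_sum_mul_of_partialSum_le {q : ℕ} {d x u : Fin q → ℝ} (hd : Antitone d)
    (h : ∀ j ≤ q, partialSum x j ≤ partialSum u j)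
    (h' : (∀ i, 0 ≤ d i) ∨ ∑ i, x i = ∑ i, u i) :
    ∑ i, d i * x i ≤ ∑ i, d i * u i := by
  have hw : ∀ j ≤ q, 0 ≤ partialSum (u - x) j := fun j hj => by
    have := h j hj
    simp only [partialSum, Pi.sub_apply, Finset.sum_sub_distrib] at *
    linarith
  have key : 0 ≤ ∑ i, d i * (u - x) i := by
    rcases h' with h' | h'
    · simpa using mul_sum_le_sum_mul_of_partialSum_nonneg hd hw h'
    · rcases q with _ | q
      · simp
      · have := mul_sum_le_sum_mul_of_partialSum_nonneg hd hw (c := d (Fin.last q))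
          (fun i => hd (Fin.le_last _))
        simpa [h'] using this
  simp only [Pi.sub_apply, mul_sub, Finset.sum_sub_distrib] at key
  linarith

/-- Rearrangement inequality: sorting `c` like `x` maximizes the pairing. -/
theorem exists_perm_sum_mul_le {q : ℕ} (c : Fin q → ℝ) {x : Fin q → ℝ} (hx : Antitone x) :
    ∃ π : Equiv.Perm (Fin q), Antitone (c ∘ π) ∧ ∑ i, c i * x i ≤ ∑ i, (c ∘ π) i * x i := by
  let π : Equiv.Perm (Fin q) := Tuple.sort (fun i => -c i)
  have hπ : Antitone (c ∘ π) := fun i j hij => by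
    have := Tuple.monotone_sort (fun i => -c i) hij
    simpa [π] using this
  refine ⟨π, hπ, ?_⟩
  have hm : Monovary (c ∘ π) x := hπ.monovary hx
  simpa using hm.sum_comp_perm_mul_le_sum_mul (σ := π⁻¹)

/-- Hahn–Banach: the hull of a finite set is compact, so a point outside it would be strictly
separated by some linear form `c`. -/
theorem mem_convexHull_of_forall_sum_mul_le {q : ℕ} {S : Set (Fin q → ℝ)} (hS : S.Finite)
    {x : Fin q → ℝ} (h : ∀ c : Fin q → ℝ, ∃ y ∈ S, ∑ i, c i * x i ≤ ∑ i, c i * y i) :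
    x ∈ convexHull ℝ S := by
  by_contra hx
  obtain ⟨f, a, hf, hfx⟩ := geometric_hahn_banach_closed_point (convex_convexHull ℝ S)
    (hS.isCompact_convexHull (𝕜 := ℝ)).isClosed hx
  have hsum : ∀ y, f y = ∑ i, f (Pi.single i 1) * y i := fun y => by
    conv_lhs => rw [pi_eq_sum_univ' y]
    rw [map_sum]
    refine Finset.sum_congr rfl fun i _ => ?_
    rw [map_smul, smul_eq_mul, mul_comm]
  obtain ⟨y, hy, hxy⟩ := h fun i => f (Pi.single i 1)
  rw [← hsum, ← hsum] at hxy
  linarith [hf y (subset_convexHull ℝ S hy)]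

/-- A vector majorized by `u` is a convex combination of permutations of `u`. -/
theorem mem_convexHull_perm {q : ℕ} {x u : Fin q → ℝ} (hx : Antitone x)
    (h : ∀ j ≤ q, partialSum x j ≤ partialSum u j) (h' : ∑ i, x i = ∑ i, u i) :
    x ∈ convexHull ℝ (Set.range fun π : Equiv.Perm (Fin q) => u ∘ π) := by
  refine mem_convexHull_of_forall_sum_mul_le (Set.finite_range _) fun c => ?_
  obtain ⟨π, hπ, hle⟩ := exists_perm_sum_mul_le c hx
  refine ⟨_, ⟨π⁻¹, rfl⟩, hle.trans
    ((sum_mul_le_sum_mul_of_partialSum_le hπ h (.inr h')).trans_eq ?_)⟩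
  rw [← Equiv.sum_comp π⁻¹]
  simp

/-- A vector weakly majorized by `u` is a convex combination of signed permutations of `u`. -/
theorem mem_convexHull_signed_perm {q : ℕ} {x u : Fin q → ℝ} (hx : Antitone x) (hx0 : ∀ i, 0 ≤ x i)
    (h : ∀ j ≤ q, partialSum x j ≤ partialSum u j) :
    x ∈ convexHull ℝ (Set.range fun p : (Fin q → ℤˣ) × Equiv.Perm (Fin q) =>
      fun i => ((p.1 i : ℤ) : ℝ) * u (p.2 i)) := by
  refine mem_convexHull_of_forall_sum_mul_le (Set.finite_range _) fun c => ?_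
  obtain ⟨π, hπ, hle⟩ := exists_perm_sum_mul_le (fun i => |c i|) hx
  -- The signs turn each `c i` into `|c i|`, and `π⁻¹` undoes the sorting.
  refine ⟨_, ⟨(fun i => if 0 ≤ c i then 1 else -1, π⁻¹), rfl⟩, ?_⟩
  calc ∑ i, c i * x i ≤ ∑ i, |c i| * x i :=
        Finset.sum_le_sum fun i _ => mul_le_mul_of_nonneg_right (le_abs_self _) (hx0 i)
    _ ≤ _ := hle
    _ ≤ _ := sum_mul_le_sum_mul_of_partialSum_le hπ h (.inl fun i => abs_nonneg _)
    _ = _ := by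
      rw [← Equiv.sum_comp π⁻¹]
      refine Finset.sum_congr rfl fun i _ => ?_
      by_cases hc : 0 ≤ c i
      · simp [hc, abs_of_nonneg hc]
      · simp [hc, abs_of_neg (not_le.mp hc)]

/-- The minimum in the variational formula for the sum of the `j` largest coordinates. -/
theorem exists_sum_posPart_add_le {q : ℕ} {x : Fin q → ℝ} (hx : Antitone x) {j : ℕ} (hj : j ≤ q) :
    ∃ z : ℝ, ((∀ i, 0 ≤ x i) → 0 ≤ z) ∧ j * z + ∑ i, max (x i - z) 0 ≤ partialSum x j := by
  rcases j with _ | j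
  · refine ⟨∑ i, |x i|, fun _ => by positivity, ?_⟩
    have : ∀ i, max (x i - ∑ i, |x i|) 0 = 0 := fun i => by
      rw [max_eq_right]
      have := Finset.single_le_sum (f := fun i => |x i|) (fun i _ => abs_nonneg _)
        (Finset.mem_univ i)
      linarith [le_abs_self (x i)]
    simp [this, partialSum]
  · refine ⟨x ⟨j, hj⟩, fun h => h _, ?_⟩
    have h1 : ∑ i, max (x i - x ⟨j, hj⟩) 0 =
        ∑ i : Fin q with i.val < j + 1, (x i - x ⟨j, hj⟩) := by
      rw [Finset.sum_filter]
      refine Finset.sum_congr rfl fun i _ => ?_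
      split_ifs with hi
      · rw [max_eq_left]
        have := hx (a := i) (b := ⟨j, hj⟩) (Fin.mk_le_mk.mpr (by omega))
        linarith
      · rw [max_eq_right]
        have := hx (a := ⟨j, hj⟩) (b := i) (Fin.mk_le_mk.mpr (by omega))
        linarith
    have h2 : (Finset.univ.filter fun i : Fin q => i.val < j + 1).card = j + 1 := by
      rw [Fin.card_filter_val_lt]
      omega
    rw [h1, Finset.sum_sub_distrib, Finset.sum_const, h2, nsmul_eq_mul, partialSum]
    simp

/-! ### Ky Fan's semidefinite programs. -/

section KyFan

variable {k m n : ℕ}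

/-- The rows of `A` are orthonormal, so this is the orthogonal projection onto the complement of
their span. -/
theorem transpose_mul_self_one_sub {A : Matrix (Fin k) (Fin m) ℝ} (hA : A * Aᵀ = 1) :
    (1 - Aᵀ * A)ᵀ = 1 - Aᵀ * A ∧ (1 - Aᵀ * A) * (1 - Aᵀ * A) = 1 - Aᵀ * A := by
  have h : Aᵀ * A * (Aᵀ * A) = Aᵀ * A := by
    rw [Matrix.mul_assoc, ← Matrix.mul_assoc A, hA, Matrix.one_mul]
  refine ⟨by simp, ?_⟩
  rw [Matrix.sub_mul, Matrix.mul_sub, Matrix.mul_sub, h]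
  simp

theorem posSemidef_one_sub_transpose_mul {A : Matrix (Fin k) (Fin m) ℝ} (hA : A * Aᵀ = 1) :
    (1 - Aᵀ * A).PosSemidef := by
  obtain ⟨h1, h2⟩ := transpose_mul_self_one_sub hA
  have := posSemidef_conjTranspose_mul_self (1 - Aᵀ * A)
  rwa [conjTranspose_eq_transpose_of_trivial, h1, h2] at this

/-- The difference is the trace of the compression of `P` to the complement of the row space, which
is positive semidefinite. -/
theorem trace_mul_mul_transpose_le {A : Matrix (Fin k) (Fin m) ℝ} (hA : A * Aᵀ = 1)
    {P : Matrix (Fin m) (Fin m) ℝ} (hP : P.PosSemidef) : (A * P * Aᵀ).trace ≤ P.trace := by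
  obtain ⟨h1, h2⟩ := transpose_mul_self_one_sub hA
  have h3 := (hP.mul_mul_conjTranspose_same (1 - Aᵀ * A)).trace_nonneg
  rw [conjTranspose_eq_transpose_of_trivial, h1, Matrix.trace_mul_cycle, h2, Matrix.sub_mul,
    Matrix.one_mul, Matrix.trace_sub, Matrix.trace_mul_cycle] at h3
  rw [Matrix.trace_mul_cycle, Matrix.trace_mul_cycle]
  linarith

theorem sum_filter_le_trace {P : Matrix (Fin k) (Fin k) ℝ} (hP : P.PosSemidef) (j : ℕ) :
    ∑ i : Fin k with i.val < j, P i i ≤ P.trace :=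
  Finset.sum_le_sum_of_subset_of_nonneg (Finset.filter_subset _ _) fun _ _ _ => hP.diag_nonneg

theorem sum_filter_const (z : ℝ) {j : ℕ} (hj : j ≤ k) :
    ∑ _i : Fin k with _i.val < j, z = j * z := by
  rw [Finset.sum_const, Fin.card_filter_val_lt, min_eq_right hj, nsmul_eq_mul]

theorem posSemidef_transpose_mul_mul {P : Matrix (Fin k) (Fin k) ℝ} (hP : P.PosSemidef)
    (A : Matrix (Fin k) (Fin m) ℝ) : (Aᵀ * P * A).PosSemidef := by
  simpa using hP.conjTranspose_mul_mul_same A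

theorem trace_transpose_mul_mul {A : Matrix (Fin k) (Fin m) ℝ} (hA : A * Aᵀ = 1)
    (P : Matrix (Fin k) (Fin k) ℝ) : (Aᵀ * P * A).trace = P.trace := by
  rw [Matrix.trace_mul_cycle, hA, Matrix.one_mul]

/-- Ky Fan: the sum of the `j` largest eigenvalues is the value of a semidefinite program. -/
theorem partialSum_le_iff_of_spectral {q : ℕ} {A : Matrix (Fin q) (Fin q) ℝ} (hA : A * Aᵀ = 1)
    {x : Fin q → ℝ} (hx : Antitone x) {j : ℕ} (hj : j ≤ q) (t : ℝ) :
    partialSum x j ≤ t ↔ ∃ (z : ℝ) (Z : Matrix (Fin q) (Fin q) ℝ), Z.PosSemidef ∧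
      (Z - Aᵀ * diagonal x * A + z • 1).PosSemidef ∧ j * z + Z.trace ≤ t := by
  constructor
  · intro h
    obtain ⟨z, -, hz⟩ := exists_sum_posPart_add_le hx hj
    -- The optimal `Z` is the positive part of `M - z • 1`, where `M = Aᵀ diag(x) A`.
    refine ⟨z, Aᵀ * diagonal (fun i => max (x i - z) 0) * A,
      posSemidef_transpose_mul_mul (.diagonal fun i => le_max_right _ _) A, ?_, ?_⟩
    · have hA' : Aᵀ * A = 1 := mul_eq_one_comm.mp hA
      have : Aᵀ * diagonal (fun i => max (x i - z) 0) * A - Aᵀ * diagonal x * A + z • 1 =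
          Aᵀ * diagonal (fun i => max (x i - z) 0 - x i + z) * A := by
        have e : diagonal (fun i => max (x i - z) 0 - x i + z) =
            diagonal (fun i => max (x i - z) 0) - diagonal x + z • (1 : Matrix (Fin q) (Fin q) ℝ) := by
          ext i l
          by_cases h : i = l
          · subst h; simp
          · simp [h]
        rw [e, Matrix.mul_add, Matrix.add_mul, Matrix.mul_sub, Matrix.sub_mul, Matrix.mul_smul,
          Matrix.smul_mul, Matrix.mul_one, hA']
      rw [this]
      exact posSemidef_transpose_mul_mul (.diagonal fun i => by
        have := le_max_left (x i - z) 0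
        simp only [Pi.zero_apply]
        linarith) A
    · rw [trace_transpose_mul_mul hA, trace_diagonal]
      linarith
  · rintro ⟨z, Z, hZ, hZx, ht⟩
    -- In the eigenbasis, nonnegativity of the diagonal bounds each `x i` by `(A Z Aᵀ) i i + z`.
    have h1 := hZx.mul_mul_conjTranspose_same A
    have h2 := hZ.mul_mul_conjTranspose_same A
    rw [conjTranspose_eq_transpose_of_trivial] at h1 h2
    have e : A * (Z - Aᵀ * diagonal x * A + z • 1) * Aᵀ = A * Z * Aᵀ - diagonal x + z • 1 := by
      have : A * (Aᵀ * diagonal x * A) * Aᵀ = (A * Aᵀ) * diagonal x * (A * Aᵀ) := by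
        simp only [Matrix.mul_assoc]
      rw [Matrix.mul_add, Matrix.add_mul, Matrix.mul_sub, Matrix.sub_mul, this, Matrix.mul_smul,
        Matrix.smul_mul, Matrix.mul_one, hA, Matrix.one_mul, Matrix.mul_one]
    rw [e] at h1
    have h3 : ∀ i, x i ≤ (A * Z * Aᵀ) i i + z := fun i => by
      have := h1.diag_nonneg (i := i)
      simp at this
      linarith
    calc partialSum x j ≤ ∑ i : Fin q with i.val < j, ((A * Z * Aᵀ) i i + z) :=
          Finset.sum_le_sum fun i _ => h3 i
      _ = ∑ i : Fin q with i.val < j, (A * Z * Aᵀ) i i + j * z := by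
          rw [Finset.sum_add_distrib, sum_filter_const z hj]
      _ ≤ Z.trace + j * z := by
          gcongr
          exact (sum_filter_le_trace h2 j).trans (trace_mul_mul_transpose_le hA hZ)
      _ ≤ t := by linarith

/-- Ky Fan: the sum of the `j` largest singular values is the value of a semidefinite program. -/
theorem partialSum_le_iff_of_svd {A : Matrix (Fin k) (Fin m) ℝ} {B : Matrix (Fin k) (Fin n) ℝ}
    (hA : A * Aᵀ = 1) (hB : B * Bᵀ = 1) {x : Fin k → ℝ} (hx : x ∈ DeltaPlus k) {j : ℕ} (hj : j ≤ k)
    (t : ℝ) :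
    partialSum x j ≤ t ↔ ∃ (z : ℝ) (P : Matrix (Fin m) (Fin m) ℝ) (Q : Matrix (Fin n) (Fin n) ℝ),
      P.PosSemidef ∧ Q.PosSemidef ∧
      (fromBlocks (P + z • 1) (Aᵀ * diagonal x * B) (Aᵀ * diagonal x * B)ᵀ
        (Q + z • 1)).PosSemidef ∧ 2 * (j * z) + P.trace + Q.trace ≤ 2 * t := by
  constructor
  · intro h
    obtain ⟨z, hz0, hz⟩ := exists_sum_posPart_add_le hx.1 hj
    replace hz0 := hz0 hx.2
    let D : Matrix (Fin k) (Fin k) ℝ := diagonal fun i => max (x i - z) 0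
    have hD : D.PosSemidef := .diagonal fun i => le_max_right _ _
    refine ⟨z, Aᵀ * D * A, Bᵀ * D * B, posSemidef_transpose_mul_mul hD A,
      posSemidef_transpose_mul_mul hD B, ?_, ?_⟩
    · have key : ∀ {l : ℕ} {C : Matrix (Fin k) (Fin l) ℝ}, C * Cᵀ = 1 →
          (Cᵀ * D * C + z • 1 - Cᵀ * diagonal x * C).PosSemidef := by
        intro l C hC
        have : Cᵀ * D * C + z • 1 - Cᵀ * diagonal x * C =
            Cᵀ * diagonal (fun i => max (x i - z) 0 - x i + z) * C + z • (1 - Cᵀ * C) := by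
          have e : diagonal (fun i => max (x i - z) 0 - x i + z) =
              D - diagonal x + z • (1 : Matrix (Fin k) (Fin k) ℝ) := by
            ext i l
            by_cases h : i = l
            · subst h; simp [D]
            · simp [D, h]
          rw [e, Matrix.mul_add, Matrix.add_mul, Matrix.mul_sub, Matrix.sub_mul, Matrix.mul_smul,
            Matrix.smul_mul, Matrix.mul_one, smul_sub]
          abel
        rw [this]
        -- `C` need not be square, so `z • (1 - Cᵀ C)` is left over; here `0 ≤ z` is needed.
        refine (posSemidef_transpose_mul_mul (.diagonal fun i => ?_) C).add
          ((posSemidef_one_sub_transpose_mul hC).smul hz0)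
        have := le_max_left (x i - z) 0
        simp only [Pi.zero_apply]
        linarith
      -- The Gram-type matrix `[A B]ᵀ diag(x) [A B]` supplies the off-diagonal blocks.
      have e : fromBlocks (Aᵀ * D * A + z • 1) (Aᵀ * diagonal x * B) (Aᵀ * diagonal x * B)ᵀ
          (Bᵀ * D * B + z • 1) =
          fromBlocks (Aᵀ * D * A + z • 1 - Aᵀ * diagonal x * A) 0 0
            (Bᵀ * D * B + z • 1 - Bᵀ * diagonal x * B) +
          (fromCols A B)ᵀ * diagonal x * fromCols A B := by
        rw [transpose_fromCols, fromRows_mul, fromRows_mul_fromCols, fromBlocks_add]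
        simp [Matrix.transpose_mul, Matrix.mul_assoc]
      rw [e]
      refine (Matrix.posSemidef_fromBlocks_zero_iff.mpr ⟨key hA, key hB⟩).add ?_
      simpa using (Matrix.PosSemidef.diagonal hx.2).conjTranspose_mul_mul_same (fromCols A B)
    · rw [trace_transpose_mul_mul hA, trace_transpose_mul_mul hB, trace_diagonal]
      linarith
  · rintro ⟨z, P, Q, hP, hQ, hPQ, ht⟩
    -- With the sign on `B`, the two off-diagonal blocks together contribute `-2 diag(x)`, which
    -- yields upper bounds on `x`.
    have h1 := hPQ.mul_mul_conjTranspose_same (fromCols A (-B))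
    have hP' := hP.mul_mul_conjTranspose_same A
    have hQ' := hQ.mul_mul_conjTranspose_same B
    rw [conjTranspose_eq_transpose_of_trivial] at h1 hP' hQ'
    have e : fromCols A (-B) * fromBlocks (P + z • 1) (Aᵀ * diagonal x * B)
        (Aᵀ * diagonal x * B)ᵀ (Q + z • 1) * (fromCols A (-B))ᵀ =
        A * P * Aᵀ + B * Q * Bᵀ + (2 * z) • 1 - (2 : ℝ) • diagonal x := by
      have e1 : A * (Aᵀ * diagonal x * B) * Bᵀ = diagonal x := by
        calc _ = (A * Aᵀ) * diagonal x * (B * Bᵀ) := by simp only [Matrix.mul_assoc]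
          _ = _ := by rw [hA, hB, Matrix.one_mul, Matrix.mul_one]
      have e2 : B * (Aᵀ * diagonal x * B)ᵀ * Aᵀ = diagonal x := by
        calc _ = (B * Bᵀ) * diagonal x * (A * Aᵀ) := by
              simp only [Matrix.mul_assoc, Matrix.transpose_mul, diagonal_transpose,
                transpose_transpose]
          _ = _ := by rw [hA, hB, Matrix.one_mul, Matrix.mul_one]
      have e3 : A * (P + z • 1) * Aᵀ = A * P * Aᵀ + z • 1 := by
        rw [Matrix.mul_add, Matrix.add_mul, Matrix.mul_smul, Matrix.smul_mul, Matrix.mul_one, hA]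
      have e4 : B * (Q + z • 1) * Bᵀ = B * Q * Bᵀ + z • 1 := by
        rw [Matrix.mul_add, Matrix.add_mul, Matrix.mul_smul, Matrix.smul_mul, Matrix.mul_one, hB]
      rw [transpose_fromCols, fromCols_mul_fromBlocks, fromCols_mul_fromRows, Matrix.add_mul,
        Matrix.add_mul, transpose_neg]
      simp only [Matrix.neg_mul, Matrix.mul_neg, e1, e2, e3, e4, neg_neg, two_smul, two_mul,
        add_smul]
      abel
    rw [e] at h1
    have h3 : ∀ i, 2 * x i ≤ (A * P * Aᵀ) i i + (B * Q * Bᵀ) i i + 2 * z := fun i => by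
      have := h1.diag_nonneg (i := i)
      simp at this
      linarith
    have h4 : 2 * partialSum x j ≤ 2 * t := by
      calc 2 * partialSum x j ≤
            ∑ i : Fin k with i.val < j, ((A * P * Aᵀ) i i + (B * Q * Bᵀ) i i + 2 * z) := by
            rw [partialSum, Finset.mul_sum]
            exact Finset.sum_le_sum fun i _ => h3 i
        _ = ∑ i : Fin k with i.val < j, (A * P * Aᵀ) i i +
              ∑ i : Fin k with i.val < j, (B * Q * Bᵀ) i i + j * (2 * z) := by
            rw [Finset.sum_add_distrib, Finset.sum_add_distrib, sum_filter_const (2 * z) hj]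
        _ ≤ P.trace + Q.trace + j * (2 * z) := by
            gcongr
            · exact (sum_filter_le_trace hP' j).trans (trace_mul_mul_transpose_le hA hP)
            · exact (sum_filter_le_trace hQ' j).trans (trace_mul_mul_transpose_le hB hQ)
        _ ≤ 2 * t := by linarith
    linarith

/-- The eigenvalues are determined by the matrix. -/
theorem eq_of_spectral_eq {q : ℕ} {A A' : Matrix (Fin q) (Fin q) ℝ} (hA : A * Aᵀ = 1)
    (hA' : A' * A'ᵀ = 1) {x x' : Fin q → ℝ} (hx : Antitone x) (hx' : Antitone x')
    (h : Aᵀ * diagonal x * A = A'ᵀ * diagonal x' * A') : x = x' := by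
  -- By the semidefinite program, the upper bounds of each partial sum depend on the matrix alone.
  refine eq_of_partialSum_eq fun j hj => eq_of_forall_ge_iff fun t => ?_
  rw [partialSum_le_iff_of_spectral hA hx hj, partialSum_le_iff_of_spectral hA' hx' hj, h]

/-- The singular values are determined by the matrix. -/
theorem eq_of_svd_eq {A A' : Matrix (Fin k) (Fin m) ℝ} {B B' : Matrix (Fin k) (Fin n) ℝ}
    (hA : A * Aᵀ = 1) (hA' : A' * A'ᵀ = 1) (hB : B * Bᵀ = 1) (hB' : B' * B'ᵀ = 1)
    {x x' : Fin k → ℝ} (hx : x ∈ DeltaPlus k) (hx' : x' ∈ DeltaPlus k)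
    (h : Aᵀ * diagonal x * B = A'ᵀ * diagonal x' * B') : x = x' := by
  refine eq_of_partialSum_eq fun j hj => eq_of_forall_ge_iff fun t => ?_
  rw [partialSum_le_iff_of_svd hA hB hx hj, partialSum_le_iff_of_svd hA' hB' hx' hj, h]

end KyFan

/-! ### Ordered spectral and singular value decompositions. -/

/-- Spectral decomposition with the eigenvalues in nonincreasing order. -/
theorem exists_spectral_decomposition {q : ℕ} {M : Matrix (Fin q) (Fin q) ℝ}
    (hM : M.IsHermitian) :
    ∃ A : Matrix (Fin q) (Fin q) ℝ, A * Aᵀ = 1 ∧ M = Aᵀ * diagonal (eigenVec hM) * A := by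
  -- The library indexes `eigenvalues` through a chosen equivalence; `e` passes back to the sorted
  -- order.
  let e : Fin q ≃ Fin q :=
    (finCongr (Fintype.card_fin q).symm).trans (Fintype.equivOfCardEq (Fintype.card_fin _))
  have he : eigenVec hM = hM.eigenvalues ∘ e := by
    ext i
    simp [eigenVec, Matrix.IsHermitian.eigenvalues, e]
  let U : Matrix (Fin q) (Fin q) ℝ := hM.eigenvectorUnitary
  have hU : Uᵀ * U = 1 := by
    have := (Matrix.mem_unitaryGroup_iff').mp hM.eigenvectorUnitary.2
    simpa [star_eq_conjTranspose] using this
  refine ⟨Uᵀ.submatrix e id, ?_, ?_⟩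
  · rw [transpose_submatrix, transpose_transpose,
      ← submatrix_mul _ _ _ id _ Function.bijective_id, hU]
    simp
  · have h := hM.spectral_theorem
    rw [Unitary.conjStarAlgAut_apply] at h
    have hd : diagonal (eigenVec hM) = (diagonal hM.eigenvalues).submatrix e e := by
      rw [he, submatrix_diagonal_equiv]
    rw [hd, transpose_submatrix, transpose_transpose, submatrix_mul_equiv, submatrix_mul_equiv]
    simpa [star_eq_conjTranspose, U, Function.comp_def] using h

theorem antitone_eigenVec {q : ℕ} {M : Matrix (Fin q) (Fin q) ℝ} (hM : M.IsHermitian) :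
    Antitone (eigenVec hM) :=
  fun _ _ h => hM.eigenvalues₀_antitone (by simpa using h)

theorem of_mul_transpose_eq_one_of_orthonormal {k m : ℕ} {a : Fin k → EuclideanSpace ℝ (Fin m)}
    (ha : Orthonormal ℝ a) :
    (Matrix.of fun i l => a i l) * (Matrix.of fun i l => a i l)ᵀ = 1 := by
  ext i l
  have := orthonormal_iff_ite.mp ha i l
  rw [EuclideanSpace.inner_eq_star_dotProduct, dotProduct_comm] at this
  simp only [Matrix.mul_apply, Matrix.one_apply, transpose_apply, of_apply]
  simpa [dotProduct] using this

/-- Thin singular value decomposition. -/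
theorem exists_svd {m n : ℕ} (M : Matrix (Fin m) (Fin n) ℝ) :
    ∃ (A : Matrix (Fin (min m n)) (Fin m) ℝ) (B : Matrix (Fin (min m n)) (Fin n) ℝ),
      A * Aᵀ = 1 ∧ B * Bᵀ = 1 ∧ M = Aᵀ * diagonal (singularVec M).val * B := by
  let T := Matrix.toEuclideanLin M
  have hn : Module.finrank ℝ (EuclideanSpace ℝ (Fin n)) = n := finrank_euclideanSpace_fin
  let b := T.isSymmetric_adjoint_comp_self.eigenvectorBasis hn
  have hinner : ∀ i j, inner ℝ (T (b i)) (T (b j)) =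
      if i = j then T.singularValues j ^ 2 else 0 := fun i j => by
    have h1 := T.isSymmetric_adjoint_comp_self.apply_eigenvectorBasis hn j
    rw [← LinearMap.adjoint_inner_right, ← LinearMap.comp_apply, h1, inner_smul_right,
      orthonormal_iff_ite.mp b.orthonormal i j, T.sq_singularValues_fin hn]
    simp
  have hzero : ∀ j : Fin n, T.singularValues j = 0 → T (b j) = 0 := fun j hj => by
    have := hinner j j
    simpa [hj] using this
  have hle : Module.finrank ℝ T.range ≤ m :=
    (Submodule.finrank_le _).trans finrank_euclideanSpace_fin.le
  -- Left singular vectors `T bᵢ / σᵢ`. They are orthonormal where `σᵢ ≠ 0`, and only those are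
  -- extended to a basis.
  let v : Fin m → EuclideanSpace ℝ (Fin m) := fun i =>
    if h : i.val < n then (T.singularValues i)⁻¹ • T (b ⟨i, h⟩) else 0
  let s : Set (Fin m) := {i | i.val < n ∧ T.singularValues i ≠ 0}
  have hv : Orthonormal ℝ (s.domRestrict v) := by
    rw [orthonormal_iff_ite]
    rintro ⟨i, hi, hi0⟩ ⟨j, hj, hj0⟩
    change inner ℝ (v i) (v j) = _
    simp only [v, dif_pos hi, dif_pos hj, inner_smul_left, inner_smul_right, hinner]
    by_cases h : i = j
    · subst h
      have : T.singularValues i ≠ 0 := hi0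
      simp
      field_simp
    · have h' : i.val ≠ j.val := fun h' => h (Fin.ext h')
      simp [h, h']
  obtain ⟨a, ha⟩ := hv.exists_orthonormalBasis_extension_of_card_eq (by simp)
  have hm' : min m n ≤ m := min_le_left _ _
  have hn' : min m n ≤ n := min_le_right _ _
  have hA := of_mul_transpose_eq_one_of_orthonormal
    (a.orthonormal.comp _ (Fin.castLE_injective hm'))
  have hB := of_mul_transpose_eq_one_of_orthonormal
    (b.orthonormal.comp _ (Fin.castLE_injective hn'))
  refine ⟨_, _, hA, hB, ?_⟩
  apply Matrix.toEuclideanLin.injective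
  refine b.toBasis.ext fun j => ?_
  rw [OrthonormalBasis.coe_toBasis]
  change T (b j) = _
  have hBj : (Matrix.of fun i l => (b ∘ Fin.castLE hn') i l) *ᵥ (b j).ofLp =
      fun i => if i.val = j.val then 1 else 0 := by
    ext i
    have := orthonormal_iff_ite.mp b.orthonormal (Fin.castLE hn' i) j
    rw [EuclideanSpace.inner_eq_star_dotProduct, dotProduct_comm] at this
    simpa [mulVec, dotProduct, Fin.ext_iff] using this
  change _ = WithLp.toLp 2 (_ *ᵥ (b j).ofLp)
  rw [← mulVec_mulVec, ← mulVec_mulVec, hBj]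
  by_cases hj : T.singularValues j = 0
  · rw [hzero j hj]
    have : diagonal (singularVec M).val *ᵥ (fun i : Fin (min m n) =>
        if i.val = j.val then (1 : ℝ) else 0) = 0 := by
      ext i
      rw [mulVec_diagonal]
      split_ifs with h
      · simpa [singularVec, h] using hj
      · simp
    rw [this, mulVec_zero]
    simp
  -- A nonzero `σⱼ` forces `j` below the rank, which is at most `m`.
  · have hjm : j.val < m := by
      by_contra h
      exact hj (T.singularValues_eq_zero_iff_le_finrank_range.mpr (by omega))
    have hjk : j.val < min m n := by simp [hjm]
    have : diagonal (singularVec M).val *ᵥ (fun i : Fin (min m n) =>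
        if i.val = j.val then (1 : ℝ) else 0) =
        Pi.single ⟨j, hjk⟩ (T.singularValues j) := by
      ext i
      rw [mulVec_diagonal]
      by_cases h : i = ⟨j, hjk⟩
      · subst h
        simp [singularVec, T]
      · have h' : i.val ≠ j.val := fun h' => h (Fin.ext h')
        simp [h, h']
    rw [this, mulVec_single]
    have haj := ha ⟨j, hjm⟩ ⟨j.isLt, hj⟩
    simp only [v, j.isLt, dif_pos, Fin.eta] at haj
    ext l
    have h2 : T (b j) l = T.singularValues j * a ⟨j, hjm⟩ l := by
      rw [haj]
      simp
      field_simp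
    rw [h2]
    simp [mul_comm]

/-! ### Rank, permutations and hulls under `x ↦ Aᵀ diag(x) B`. -/

section Decomposition

variable {k m n : ℕ}

/-- A positive entry at `i` makes all `i + 1` entries up to it positive, so the rank would exceed
`K`. -/
theorem eq_zero_of_rank_diagonal_le {x : Fin k → ℝ} (hx : x ∈ DeltaPlus k) {K : ℕ}
    (h : (diagonal x).rank ≤ K) (i : Fin k) (hi : K ≤ i.val) : x i = 0 := by
  by_contra hne
  rw [rank_diagonal, Fintype.card_subtype] at h
  have hpos : 0 < x i := lt_of_le_of_ne (hx.2 i) (Ne.symm hne)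
  have hsub : Finset.Iic i ⊆ Finset.univ.filter fun l => x l ≠ 0 := fun l hl => by
    simpa using (hpos.trans_le (hx.1 (Finset.mem_Iic.mp hl))).ne'
  have := Finset.card_le_card hsub
  rw [Fin.card_Iic] at this
  omega

theorem rank_diagonal_le {x : Fin k → ℝ} {K : ℕ} (h : ∀ i : Fin k, K ≤ i.val → x i = 0) :
    (diagonal x).rank ≤ K := by
  rw [rank_diagonal, Fintype.card_subtype]
  have hsub : (Finset.univ.filter fun l => x l ≠ 0) ⊆ Finset.univ.filter fun l => l.val < K :=
    fun l hl => by
      simp only [Finset.mem_filter, Finset.mem_univ, true_and] at *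
      by_contra hl'
      exact hl (h l (not_lt.mp hl'))
  refine (Finset.card_le_card hsub).trans ?_
  rw [Fin.card_filter_val_lt]
  exact min_le_right _ _

theorem rank_transpose_mul_mul_le (A : Matrix (Fin k) (Fin m) ℝ) (B : Matrix (Fin k) (Fin n) ℝ)
    (P : Matrix (Fin k) (Fin k) ℝ) : (Aᵀ * P * B).rank ≤ P.rank :=
  (rank_mul_le_left _ _).trans (rank_mul_le_right _ _)

theorem rank_le_rank_transpose_mul_mul {A : Matrix (Fin k) (Fin m) ℝ}
    {B : Matrix (Fin k) (Fin n) ℝ} (hA : A * Aᵀ = 1) (hB : B * Bᵀ = 1)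
    (P : Matrix (Fin k) (Fin k) ℝ) : P.rank ≤ (Aᵀ * P * B).rank := by
  have : A * (Aᵀ * P * B) * Bᵀ = P := by
    calc _ = (A * Aᵀ) * P * (B * Bᵀ) := by simp only [Matrix.mul_assoc]
      _ = _ := by rw [hA, hB, Matrix.one_mul, Matrix.mul_one]
  conv_lhs => rw [← this]
  exact (rank_mul_le_left _ _).trans (rank_mul_le_right _ _)

theorem transpose_mul_diagonal_comp_perm_mul (A : Matrix (Fin k) (Fin m) ℝ)
    (B : Matrix (Fin k) (Fin n) ℝ) (u : Fin k → ℝ) (π : Equiv.Perm (Fin k)) :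
    Aᵀ * diagonal (u ∘ π) * B =
      (A.submatrix π.symm id)ᵀ * diagonal u * B.submatrix π.symm id := by
  have : diagonal u = (diagonal (u ∘ π)).submatrix π.symm π.symm := by
    rw [submatrix_diagonal_equiv]
    congr 1
    ext
    simp
  rw [this, transpose_submatrix, submatrix_mul_equiv, submatrix_mul_equiv, submatrix_id_id]

theorem submatrix_mul_transpose_self {A : Matrix (Fin k) (Fin m) ℝ} (hA : A * Aᵀ = 1)
    (π : Equiv.Perm (Fin k)) : A.submatrix π id * (A.submatrix π id)ᵀ = 1 := by
  rw [transpose_submatrix, ← submatrix_mul _ _ _ id _ Function.bijective_id, hA,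
    submatrix_one_equiv]

/-- The linear map `x ↦ Aᵀ diag(x) B`. -/
def conjDiagonal (A : Matrix (Fin k) (Fin m) ℝ) (B : Matrix (Fin k) (Fin n) ℝ) :
    (Fin k → ℝ) →ₗ[ℝ] Matrix (Fin m) (Fin n) ℝ where
  toFun x := Aᵀ * diagonal x * B
  map_add' x y := by
    change Aᵀ * diagonal (fun i => x i + y i) * B = _
    rw [← diagonal_add, Matrix.mul_add, Matrix.add_mul]
  map_smul' c x := by
    rw [diagonal_smul, Matrix.mul_smul, Matrix.smul_mul, RingHom.id_apply]

theorem conjDiagonal_mem_convexHull (A : Matrix (Fin k) (Fin m) ℝ) (B : Matrix (Fin k) (Fin n) ℝ)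
    {x : Fin k → ℝ} {S : Set (Fin k → ℝ)} {R : Set (Matrix (Fin m) (Fin n) ℝ)}
    (hx : x ∈ convexHull ℝ S) (h : ∀ y ∈ S, Aᵀ * diagonal y * B ∈ R) :
    Aᵀ * diagonal x * B ∈ convexHull ℝ R := by
  have h1 : conjDiagonal A B x ∈ conjDiagonal A B '' convexHull ℝ S := ⟨x, hx, rfl⟩
  rw [LinearMap.image_convexHull] at h1
  refine convexHull_mono ?_ h1
  rintro _ ⟨y, hy, rfl⟩
  exact h y hy

end Decomposition

/-! ### The hull in the rectangular case. -/

section Rectangular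

variable {m n : ℕ}

/-- The bound is kept as a variable, jointly with the matrix, so that a partial sum of the unknown
`u` can be substituted for it. -/
theorem semidefRepresentable_singular_partialSum_le {j : ℕ} (hj : j ≤ min m n) :
    SemidefRepresentable {p : Matrix (Fin m) (Fin n) ℝ × ℝ |
      partialSum (singularVec p.1).val j ≤ p.2} := by
  let L : (Matrix (Fin m) (Fin n) ℝ × ℝ) ×
      (ℝ × Matrix (Fin m) (Fin m) ℝ × Matrix (Fin n) (Fin n) ℝ) →ₗ[ℝ]
        Matrix (Fin m ⊕ Fin n) (Fin m ⊕ Fin n) ℝ :=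
    { toFun := fun w => fromBlocks (w.2.2.1 + w.2.1 • 1) w.1.1 w.1.1ᵀ (w.2.2.2 + w.2.1 • 1)
      map_add' := fun w w' => by
        simp only [Prod.fst_add, Prod.snd_add, transpose_add, add_smul, fromBlocks_add]
        congr 1
        · abel
        · abel
      map_smul' := fun c w => by
        simp [fromBlocks_smul, smul_smul] }
  let P : (Matrix (Fin m) (Fin n) ℝ × ℝ) ×
      (ℝ × Matrix (Fin m) (Fin m) ℝ × Matrix (Fin n) (Fin n) ℝ) →ₗ[ℝ] Matrix (Fin m) (Fin m) ℝ :=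
    LinearMap.fst _ _ _ ∘ₗ LinearMap.snd _ _ _ ∘ₗ
    LinearMap.snd _ _ _
  let Q : (Matrix (Fin m) (Fin n) ℝ × ℝ) ×
      (ℝ × Matrix (Fin m) (Fin m) ℝ × Matrix (Fin n) (Fin n) ℝ) →ₗ[ℝ] Matrix (Fin n) (Fin n) ℝ :=
    LinearMap.snd _ _ _ ∘ₗ LinearMap.snd _ _ _ ∘ₗ
    LinearMap.snd _ _ _
  let z : (Matrix (Fin m) (Fin n) ℝ × ℝ) ×
      (ℝ × Matrix (Fin m) (Fin m) ℝ × Matrix (Fin n) (Fin n) ℝ) →ₗ[ℝ] ℝ :=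
    LinearMap.fst _ _ _ ∘ₗ LinearMap.snd _ _ _
  let t : (Matrix (Fin m) (Fin n) ℝ × ℝ) ×
      (ℝ × Matrix (Fin m) (Fin m) ℝ × Matrix (Fin n) (Fin n) ℝ) →ₗ[ℝ] ℝ :=
    LinearMap.snd _ _ _ ∘ₗ LinearMap.fst _ _ _
  let ℓ : (Matrix (Fin m) (Fin n) ℝ × ℝ) ×
      (ℝ × Matrix (Fin m) (Fin m) ℝ × Matrix (Fin n) (Fin n) ℝ) →ₗ[ℝ] ℝ :=
    (2 : ℝ) • t - ((2 * j : ℝ) • z + Matrix.traceLinearMap _ ℝ ℝ ∘ₗ P +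
    Matrix.traceLinearMap _ ℝ ℝ ∘ₗ Q)
  have h := ((SemidefRepresentable.setOf_posSemidef P).inter
    ((SemidefRepresentable.setOf_posSemidef Q).inter
    ((SemidefRepresentable.setOf_posSemidef L).inter
    (SemidefRepresentable.setOf_nonneg_real ℓ)))).proj
  convert h using 1
  ext ⟨M, s⟩
  obtain ⟨A, B, hA, hB, hM⟩ := exists_svd M
  have key := partialSum_le_iff_of_svd hA hB (singularVec M).2 hj s
  rw [← hM] at key
  simp only [Set.mem_ofPred_eq, key, Set.mem_inter_iff, Prod.exists]
  refine exists_congr fun z' => exists_congr fun P' => exists_congr fun Q' =>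
    and_congr Iff.rfl (and_congr Iff.rfl (and_congr Iff.rfl ?_))
  change _ ↔ 0 ≤ 2 * s - (2 * j * z' + P'.trace + Q'.trace)
  rw [sub_nonneg, mul_assoc]

theorem semidefRepresentable_singular_majorization {K : ℕ} {r : ℝ}
    {f : DeltaPlus (min m n) → ℝ} (hf : SemidefRepresentable (lowerLevelSet f r)) :
    SemidefRepresentable {M : Matrix (Fin m) (Fin n) ℝ | ∃ u : DeltaPlus (min m n), f u ≤ r ∧
      (∀ i, K ≤ i.val → u.val i = 0) ∧
      ∀ j ≤ min m n, partialSum (singularVec M).val j ≤ partialSum u.val j} := by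
  let π : Matrix (Fin m) (Fin n) ℝ × (Fin (min m n) → ℝ) →ₗ[ℝ] (Fin (min m n) → ℝ) :=
    LinearMap.snd _ _ _
  have h1 := hf.preimage π
  have h2 := SemidefRepresentable.forall_mem
    (Finset.univ.filter fun i : Fin (min m n) => K ≤ i.val)
    (fun i _ => SemidefRepresentable.setOf_eq_zero_real (LinearMap.proj i ∘ₗ π))
  have h3 := SemidefRepresentable.forall_mem (Finset.range (min m n + 1))
    (fun j hj => (semidefRepresentable_singular_partialSum_le (m := m) (n := n)
      (Nat.lt_succ_iff.mp (Finset.mem_range.mp hj))).preimage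
        ((LinearMap.fst ℝ (Matrix (Fin m) (Fin n) ℝ) (Fin (min m n) → ℝ)).prod
          (partialSumLinear (min m n) j ∘ₗ π)))
  convert (h1.inter (h2.inter h3)).proj using 1
  ext M
  constructor
  · rintro ⟨u, hu, hK, h⟩
    refine ⟨u.val, ⟨u, hu, rfl⟩, fun i hi => hK i (Finset.mem_filter.mp hi).2, fun j hj => ?_⟩
    change _ ≤ partialSumLinear _ j u.val
    rw [partialSumLinear_apply]
    exact h j (Nat.lt_succ_iff.mp (Finset.mem_range.mp hj))
  · rintro ⟨_, ⟨u, hu, rfl⟩, hK, h⟩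
    refine ⟨u, hu, fun i hi => hK i (by simpa using hi), fun j hj => ?_⟩
    rw [← partialSumLinear_apply u.val]
    exact h j (by simpa [Nat.lt_succ_iff] using hj)

/-- Uniqueness of singular values identifies `u` with `singularVec` of the product. -/
theorem mem_rankSingularSet {K : ℕ} {r : ℝ} {f : DeltaPlus (min m n) → ℝ}
    {A : Matrix (Fin (min m n)) (Fin m) ℝ} {B : Matrix (Fin (min m n)) (Fin n) ℝ}
    (hA : A * Aᵀ = 1) (hB : B * Bᵀ = 1) {u : DeltaPlus (min m n)} (hu : f u ≤ r)
    (hK : ∀ i, K ≤ i.val → u.val i = 0) :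
    Aᵀ * diagonal u.val * B ∈ rankSingularSet K r f := by
  refine ⟨(rank_transpose_mul_mul_le _ _ _).trans (rank_diagonal_le hK), ?_⟩
  obtain ⟨A', B', hA', hB', h⟩ := exists_svd (Aᵀ * diagonal u.val * B)
  rwa [← Subtype.ext (eq_of_svd_eq hA hA' hB hB' u.2 (singularVec _).2 h)]

theorem convexHull_rankSingularSet {K : ℕ} {r : ℝ} {f : DeltaPlus (min m n) → ℝ}
    (hf : SemidefRepresentable (lowerLevelSet f r)) :
    convexHull ℝ (rankSingularSet K r f) =
      {M : Matrix (Fin m) (Fin n) ℝ | ∃ u : DeltaPlus (min m n), f u ≤ r ∧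
        (∀ i, K ≤ i.val → u.val i = 0) ∧
        ∀ j ≤ min m n, partialSum (singularVec M).val j ≤ partialSum u.val j} := by
  refine Set.Subset.antisymm (convexHull_min ?_
    (semidefRepresentable_singular_majorization hf).convex) ?_
  · rintro M ⟨hK, hr⟩
    obtain ⟨A, B, hA, hB, hM⟩ := exists_svd M
    refine ⟨singularVec M, hr, eq_zero_of_rank_diagonal_le (singularVec M).2 ?_,
      fun _ _ => le_rfl⟩
    refine (rank_le_rank_transpose_mul_mul hA hB _).trans ?_
    rwa [← hM]
  · rintro M ⟨u, hu, hK, hM⟩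
    obtain ⟨A, B, hA, hB, hAB⟩ := exists_svd M
    rw [hAB]
    refine conjDiagonal_mem_convexHull A B
      (mem_convexHull_signed_perm (singularVec M).2.1 (singularVec M).2.2 hM) ?_
    rintro _ ⟨⟨ε, π⟩, rfl⟩
    let E : Matrix (Fin (min m n)) (Fin (min m n)) ℝ := diagonal fun i => ((ε i : ℤ) : ℝ)
    have hE : E * Eᵀ = 1 := by
      rw [diagonal_transpose, diagonal_mul_diagonal, ← diagonal_one]
      congr 1
      ext i
      rcases Int.units_eq_one_or (ε i) with h | h <;> simp [h]
    -- The signs are absorbed into the left frame, whose rows stay orthonormal.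
    have hEA : (E * A) * (E * A)ᵀ = 1 := by
      rw [transpose_mul, Matrix.mul_assoc, ← Matrix.mul_assoc A, hA, Matrix.one_mul, hE]
    have e : Aᵀ * diagonal (fun i => ((ε i : ℤ) : ℝ) * u.val (π i)) * B =
        (E * A)ᵀ * diagonal (u.val ∘ π) * B := by
      rw [transpose_mul, diagonal_transpose, Matrix.mul_assoc Aᵀ (diagonal _) (diagonal _),
        diagonal_mul_diagonal]
      rfl
    simp only
    rw [e, transpose_mul_diagonal_comp_perm_mul]
    exact mem_rankSingularSet (submatrix_mul_transpose_self hEA _)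
      (submatrix_mul_transpose_self hB _) hu hK

end Rectangular

/-! ### The hull in the symmetric case. -/

section Symmetric

variable {q : ℕ}

theorem semidefRepresentable_eigen_partialSum_le {j : ℕ} (hj : j ≤ q) :
    SemidefRepresentable {p : Matrix (Fin q) (Fin q) ℝ × ℝ |
      ∃ hM : p.1.IsHermitian, partialSum (eigenVec hM) j ≤ p.2} := by
  let Z : (Matrix (Fin q) (Fin q) ℝ × ℝ) × (ℝ × Matrix (Fin q) (Fin q) ℝ) →ₗ[ℝ] Matrix (Fin q) (Fin q) ℝ :=
    LinearMap.snd _ _ _ ∘ₗ LinearMap.snd _ _ _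
  let z : (Matrix (Fin q) (Fin q) ℝ × ℝ) × (ℝ × Matrix (Fin q) (Fin q) ℝ) →ₗ[ℝ] ℝ :=
    LinearMap.fst _ _ _ ∘ₗ LinearMap.snd _ _ _
  let t : (Matrix (Fin q) (Fin q) ℝ × ℝ) × (ℝ × Matrix (Fin q) (Fin q) ℝ) →ₗ[ℝ] ℝ :=
    LinearMap.snd _ _ _ ∘ₗ LinearMap.fst _ _ _
  let L : (Matrix (Fin q) (Fin q) ℝ × ℝ) × (ℝ × Matrix (Fin q) (Fin q) ℝ) →ₗ[ℝ] Matrix (Fin q) (Fin q) ℝ :=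
    Z - LinearMap.fst _ _ _ ∘ₗ LinearMap.fst _ _ _ + z.smulRight 1
  let ℓ : (Matrix (Fin q) (Fin q) ℝ × ℝ) × (ℝ × Matrix (Fin q) (Fin q) ℝ) →ₗ[ℝ] ℝ :=
    t - ((j : ℝ) • z + Matrix.traceLinearMap _ ℝ ℝ ∘ₗ Z)
  convert ((SemidefRepresentable.setOf_posSemidef Z).inter
    ((SemidefRepresentable.setOf_posSemidef L).inter
    (SemidefRepresentable.setOf_nonneg_real ℓ))).proj using 1
  ext ⟨M, s⟩
  have key : ∀ hM : M.IsHermitian, partialSum (eigenVec hM) j ≤ s ↔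
      ∃ (z : ℝ) (Z : Matrix (Fin q) (Fin q) ℝ), Z.PosSemidef ∧
        (Z - M + z • 1).PosSemidef ∧ j * z + Z.trace ≤ s := fun hM => by
    obtain ⟨A, hA, hAM⟩ := exists_spectral_decomposition hM
    have := partialSum_le_iff_of_spectral hA (antitone_eigenVec hM) hj s
    rwa [← hAM] at this
  simp only [Set.mem_ofPred_eq, key, Set.mem_inter_iff, Prod.exists]
  have hℓ : ∀ z' Z', 0 ≤ ℓ ((M, s), z', Z') ↔ j * z' + Z'.trace ≤ s := fun z' Z' =>
    sub_nonneg (a := s) (b := j * z' + Z'.trace)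
  constructor
  · rintro ⟨-, z', Z', h1, h2, h3⟩
    exact ⟨z', Z', h1, h2, (hℓ _ _).mpr h3⟩
  · rintro ⟨z', Z', h1, h2, h3⟩
    replace h1 : Z'.PosSemidef := h1
    replace h2 : (Z' - M + z' • 1).PosSemidef := h2
    refine ⟨?_, z', Z', h1, h2, (hℓ _ _).mp h3⟩
    -- Symmetry of `M` need not be imposed: it follows from that of the two semidefinite matrices.
    have : M = Z' + z' • 1 - (Z' - M + z' • 1) := by abel
    rw [this]
    refine (h1.1.add ?_).sub h2.1
    simp [Matrix.IsHermitian]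

theorem partialSum_eigenVec_eq_trace {M : Matrix (Fin q) (Fin q) ℝ} (hM : M.IsHermitian) :
    partialSum (eigenVec hM) q = M.trace := by
  obtain ⟨A, hA, hAM⟩ := exists_spectral_decomposition hM
  conv_rhs => rw [hAM]
  rw [trace_transpose_mul_mul hA, trace_diagonal, partialSum_eq_sum _ le_rfl]

theorem semidefRepresentable_eigen_majorization {K : ℕ} {r : ℝ} {f : DeltaPlus q → ℝ}
    (hf : SemidefRepresentable (lowerLevelSet f r)) :
    SemidefRepresentable {M : Matrix (Fin q) (Fin q) ℝ | ∃ (hM : M.IsHermitian) (u : DeltaPlus q),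
      f u ≤ r ∧ (∀ i, K ≤ i.val → u.val i = 0) ∧
      (∀ j < q, partialSum (eigenVec hM) j ≤ partialSum u.val j) ∧
      partialSum (eigenVec hM) q = partialSum u.val q} := by
  let π : Matrix (Fin q) (Fin q) ℝ × (Fin q → ℝ) →ₗ[ℝ] (Fin q → ℝ) :=
    LinearMap.snd _ _ _
  have h1 := hf.preimage π
  have h2 := SemidefRepresentable.forall_mem (Finset.univ.filter fun i : Fin q => K ≤ i.val)
    (fun i _ => SemidefRepresentable.setOf_eq_zero_real (LinearMap.proj i ∘ₗ π))
  have h3 := SemidefRepresentable.forall_mem (Finset.range (q + 1))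
    (fun j hj => (semidefRepresentable_eigen_partialSum_le (q := q)
      (Nat.lt_succ_iff.mp (Finset.mem_range.mp hj))).preimage
        ((LinearMap.fst ℝ (Matrix (Fin q) (Fin q) ℝ) (Fin q → ℝ)).prod
          (partialSumLinear q j ∘ₗ π)))
  have h4 := SemidefRepresentable.setOf_eq_zero_real (Matrix.traceLinearMap (Fin q) ℝ ℝ ∘ₗ
    LinearMap.fst ℝ (Matrix (Fin q) (Fin q) ℝ) (Fin q → ℝ) - partialSumLinear q q ∘ₗ π)
  convert (h1.inter (h2.inter (h3.inter h4))).proj using 1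
  ext M
  constructor
  · rintro ⟨hM, u, hu, hK, hlt, heq⟩
    refine ⟨u.val, ⟨u, hu, rfl⟩, fun i hi => hK i (Finset.mem_filter.mp hi).2,
      fun j hj => ⟨hM, ?_⟩, ?_⟩
    · change _ ≤ partialSumLinear _ j u.val
      rw [partialSumLinear_apply]
      rcases (Nat.lt_succ_iff.mp (Finset.mem_range.mp hj)).lt_or_eq with h | rfl
      · exact hlt j h
      · exact heq.le
    · change M.trace - partialSumLinear q q u.val = 0
      rw [partialSumLinear_apply, ← heq, partialSum_eigenVec_eq_trace, sub_self]
  · rintro ⟨_, ⟨u, hu, rfl⟩, hK, h, heq⟩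
    -- The index `0` is always in range, even for `q = 0`, and carries the symmetry of `M`.
    have hM : M.IsHermitian := (h 0 (by simp)).1
    refine ⟨hM, u, hu, fun i hi => hK i (by simpa using hi), fun j hj => ?_, ?_⟩
    · rw [← partialSumLinear_apply u.val]
      exact (h j (by simpa [Nat.lt_succ_iff] using hj.le)).2
    · rw [partialSum_eigenVec_eq_trace, ← partialSumLinear_apply u.val]
      exact sub_eq_zero.mp heq

theorem mem_rankEigenSet {K : ℕ} {r : ℝ} {f : DeltaPlus q → ℝ} {A : Matrix (Fin q) (Fin q) ℝ}
    (hA : A * Aᵀ = 1) {u : DeltaPlus q} (hu : f u ≤ r) (hK : ∀ i, K ≤ i.val → u.val i = 0) :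
    Aᵀ * diagonal u.val * A ∈ rankEigenSet K r f := by
  have hpos : (Aᵀ * diagonal u.val * A).PosSemidef :=
    posSemidef_transpose_mul_mul (.diagonal u.2.2) A
  refine ⟨hpos, (rank_transpose_mul_mul_le _ _ _).trans (rank_diagonal_le hK), ?_⟩
  obtain ⟨A', hA', h⟩ := exists_spectral_decomposition hpos.isHermitian
  have e : u = ⟨eigenVec hpos.isHermitian, eigenVec_mem_deltaPlus hpos⟩ :=
    Subtype.ext (eq_of_spectral_eq hA hA' u.2.1 (antitone_eigenVec hpos.isHermitian) h)
  rwa [← e]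

theorem convexHull_rankEigenSet {K : ℕ} {r : ℝ} {f : DeltaPlus q → ℝ}
    (hf : SemidefRepresentable (lowerLevelSet f r)) :
    convexHull ℝ (rankEigenSet K r f) =
      {M : Matrix (Fin q) (Fin q) ℝ | ∃ (hM : M.IsHermitian) (u : DeltaPlus q), f u ≤ r ∧
        (∀ i, K ≤ i.val → u.val i = 0) ∧
        (∀ j < q, partialSum (eigenVec hM) j ≤ partialSum u.val j) ∧
        partialSum (eigenVec hM) q = partialSum u.val q} := by
  refine Set.Subset.antisymm (convexHull_min ?_
    (semidefRepresentable_eigen_majorization hf).convex) ?_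
  · rintro M ⟨hM, hK, hr⟩
    obtain ⟨A, hA, hAM⟩ := exists_spectral_decomposition hM.1
    refine ⟨hM.1, ⟨_, eigenVec_mem_deltaPlus hM⟩, hr,
      eq_zero_of_rank_diagonal_le (eigenVec_mem_deltaPlus hM) ?_, fun _ _ => le_rfl, rfl⟩
    refine (rank_le_rank_transpose_mul_mul hA hA _).trans ?_
    rwa [← hAM]
  · rintro M ⟨hM, u, hu, hK, hlt, heq⟩
    obtain ⟨A, hA, hAM⟩ := exists_spectral_decomposition hM
    rw [hAM]
    have hle : ∀ j ≤ q, partialSum (eigenVec hM) j ≤ partialSum u.val j := fun j hj =>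
      hj.lt_or_eq.elim (hlt j) fun h => by rw [h, heq]
    rw [partialSum_eq_sum _ le_rfl, partialSum_eq_sum _ le_rfl] at heq
    refine conjDiagonal_mem_convexHull A A (mem_convexHull_perm (antitone_eigenVec hM) hle heq) ?_
    rintro _ ⟨π, rfl⟩
    simp only
    rw [transpose_mul_diagonal_comp_perm_mul]
    exact mem_rankEigenSet (submatrix_mul_transpose_self hA _) hu hK

/-- Subtracting the inequality at `q - 1` from the equality at `q` bounds the smallest eigenvalue
below by the last entry of `u`. -/
theorem posSemidef_of_partialSum_le {M : Matrix (Fin q) (Fin q) ℝ} {hM : M.IsHermitian}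
    {u : Fin q → ℝ} (hu : ∀ i, 0 ≤ u i)
    (hlt : ∀ j < q, partialSum (eigenVec hM) j ≤ partialSum u j)
    (heq : partialSum (eigenVec hM) q = partialSum u q) : M.PosSemidef := by
  obtain ⟨A, hA, hAM⟩ := exists_spectral_decomposition hM
  rw [hAM]
  refine posSemidef_transpose_mul_mul (.diagonal fun i => ?_) A
  obtain ⟨p, rfl⟩ : ∃ p, q = p + 1 := ⟨q - 1, by have := i.isLt; omega⟩
  have h1 := hlt p (Nat.lt_succ_self p)
  have h2 := partialSum_add_eq (eigenVec hM) (Fin.last p)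
  have h3 := partialSum_add_eq u (Fin.last p)
  have h4 := hu (Fin.last p)
  have h5 := antitone_eigenVec hM (Fin.le_last i)
  simp only [Fin.val_last, Pi.zero_apply] at *
  linarith

/-- From `K` on, the partial sums of `u` are constant and equal to the trace, while those of
nonnegative eigenvalues never exceed the trace; the inequalities there are automatic. If `K > q`,
`partialSum u K` is the full sum. -/
theorem eigen_majorization_iff {K : ℕ} {M : Matrix (Fin q) (Fin q) ℝ} {u : DeltaPlus q}
    (hK : ∀ i, K ≤ i.val → u.val i = 0) :
    (∃ hM : M.IsHermitian, (∀ j < q, partialSum (eigenVec hM) j ≤ partialSum u.val j) ∧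
        partialSum (eigenVec hM) q = partialSum u.val q) ↔
      ∃ hM : M.PosSemidef,
        (∀ j < K, partialSum (eigenVec hM.isHermitian) j ≤ partialSum u.val j) ∧
        partialSum (eigenVec hM.isHermitian) q = partialSum u.val K := by
  have huK : partialSum u.val q = partialSum u.val K := by
    rcases le_total K q with h | h
    · exact partialSum_eq_of_eq_zero hK h
    · rw [partialSum_eq_sum _ le_rfl, partialSum_eq_sum _ h]
  constructor
  · rintro ⟨hM, hlt, heq⟩
    refine ⟨posSemidef_of_partialSum_le u.2.2 hlt heq, fun j _ => ?_, heq.trans huK⟩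
    rcases lt_or_ge j q with h | h
    · exact hlt j h
    · rw [partialSum_eq_sum _ h, partialSum_eq_sum _ h, ← partialSum_eq_sum _ le_rfl,
        ← partialSum_eq_sum _ le_rfl, heq]
  · rintro ⟨hM, hlt, heq⟩
    refine ⟨hM.1, fun j hj => ?_, heq.trans huK.symm⟩
    rcases lt_or_ge j K with h | h
    · exact hlt j h
    · rw [partialSum_eq_of_eq_zero hK h, ← heq]
      exact partialSum_mono (eigenVec_mem_deltaPlus hM).2 hj.le

end Symmetric

theorem theorem9 (K : ℕ) (r : ℝ) :
    (∀ (m n : ℕ) (f : DeltaPlus (min m n) → ℝ),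
      (∀ α : ℝ, SemidefRepresentable (lowerLevelSet f α)) →
        SemidefRepresentable (convexHull ℝ (rankSingularSet K r f)) ∧
        convexHull ℝ (rankSingularSet K r f) =
          {M : Matrix (Fin m) (Fin n) ℝ | ∃ u : DeltaPlus (min m n), f u ≤ r ∧
            (∀ i, K ≤ i.val → u.val i = 0) ∧
            ∀ j ≤ min m n, partialSum (singularVec M).val j ≤ partialSum u.val j}) ∧
    (∀ (q : ℕ) (f : DeltaPlus q → ℝ),
      (∀ α : ℝ, SemidefRepresentable (lowerLevelSet f α)) →
        SemidefRepresentable (convexHull ℝ (rankEigenSet K r f)) ∧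
        convexHull ℝ (rankEigenSet K r f) =
          {M : Matrix (Fin q) (Fin q) ℝ | ∃ (hM : M.IsHermitian) (u : DeltaPlus q), f u ≤ r ∧
            (∀ i, K ≤ i.val → u.val i = 0) ∧
            (∀ j < q, partialSum (eigenVec hM) j ≤ partialSum u.val j) ∧
            partialSum (eigenVec hM) q = partialSum u.val q} ∧
        convexHull ℝ (rankEigenSet K r f) =
          {M : Matrix (Fin q) (Fin q) ℝ | ∃ (hM : M.PosSemidef) (u : DeltaPlus q), f u ≤ r ∧
            (∀ i, K ≤ i.val → u.val i = 0) ∧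
            (∀ j < K, partialSum (eigenVec hM.isHermitian) j ≤ partialSum u.val j) ∧
            partialSum (eigenVec hM.isHermitian) q = partialSum u.val K}) := by
  refine ⟨fun m n f hf => ⟨?_, convexHull_rankSingularSet (hf r)⟩,
    fun q f hf => ⟨?_, convexHull_rankEigenSet (hf r), ?_⟩⟩
  · rw [convexHull_rankSingularSet (hf r)]
    exact semidefRepresentable_singular_majorization (hf r)
  · rw [convexHull_rankEigenSet (hf r)]
    exact semidefRepresentable_eigen_majorization (hf r)
  · rw [convexHull_rankEigenSet (hf r)]
    ext M
    constructor
    · rintro ⟨hM, u, hu, hK, h⟩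
      obtain ⟨hM', h'⟩ := (eigen_majorization_iff hK).mp ⟨hM, h⟩
      exact ⟨hM', u, hu, hK, h'⟩
    · rintro ⟨hM, u, hu, hK, h⟩
      obtain ⟨hM', h'⟩ := (eigen_majorization_iff hK).mpr ⟨hM, h⟩
      exact ⟨hM', u, hu, hK, h'⟩
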